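/- Let $\mathcal{X}\subseteq\mathbb{R}^d$ be Lebesgue measurable, equipped with its $\sigma$-algebra $\mathcal F$ of Lebesgue-measurable subsets. Let $\pi$ be a probability density on $\mathcal X$ with respect to Lebesgue measure (also denoting the corresponding distribution), let $\hat\pi\ge 0$ be a measurable function on $\mathcal X$ (an approximation to $\pi$) with $\hat\pi(x)>0$ whenever $\pi(x)>0$, and let $q(x,y)$ be a (jointly measurable) proposal density, so that $\int_{\mathcal X} q(x,y)\,dy=1$ for every $x\in\mathcal X$. Put $$r(x,y)=\frac{\pi(y)q(y,x)}{\pi(x)q(x,y)},\qquad r_1(x,y)=\frac{\hat\pi(y)q(y,x)}{\hat\pi(x)q(x,y)},\qquad r_2(x,y)=\frac{\pi(y)/\hat\pi(y)}{\pi(x)/\hat\pi(x)},$$ with values in $[0,\infty]$ (and $0/0:=0$, $\infty/\infty:=0$), and $$\alpha_{\mathrm{MH}}(x,y)=1\wedge r(x,y),\qquad \alpha_{\mathrm{DA}}(x,y)=[1\wedge r_1(x,y)]\,[1\wedge r_2(x,y)].$$ For $\alpha\in\{\alpha_{\mathrm{MH}},\alpha_{\mathrm{DA}}\}$ let $$P(x,dy)=q(x,y)\alpha(x,y)\,dy+\Bigl[1-\int_{\mathcal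 X} q(x,z)\alpha(x,z)\,dz\Bigr]\delta_x(dy);$$ this is the Metropolis--Hastings kernel $P_{\mathrm{MH}}$ when $\alpha=\alpha_{\mathrm{MH}}$ and the delayed-acceptance kernel $P_{\mathrm{DA}}$ when $\alpha=\alpha_{\mathrm{DA}}$. A Markov kernel $P$ with stationary distribution $\pi$ is called variance bounding if for every $h\in L^2(\pi)$ the asymptotic variance $\lim_{n\to\infty} n\,\mathrm{Var}\bigl[\frac1n\sum_{i=1}^n h(X_i)\bigr]$ exists and is finite, where $(X_i)_{i\ge1}$ is the Markov chain with kernel $P$ and $X_1\sim\pi$. For $m\in\mathbb R$ and $x\in\mathcal X$ let, with logarithms in $[-\infty,\infty]$, $$M_m(x)=\{y\in\mathcal X:\min(|\log r_1(x,y)|,|\log r_2(x,y)|)>m\},$$ $$C(x)=\{y\in\mathcal X:\operatorname{sign}[\log r_1(x,y)]\,\operatorname{sign}[\log r_2(x,y)]\ge 0\}.$$ Suppose that for every $\epsilon>0$ there is an $m<\infty$ such that for $\pi$-almost all $x$ there is a set $D(x)\in\mathcal F$ with $$M_m(x)\cap D(x)\subseteq C(x)\qquad\text{and}\qquad \int_{D(x)^c}q(x,y)\,dy\le\epsilon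 .$$ Then, if $P_{\mathrm{MH}}$ is variance bounding, so is $P_{\mathrm{DA}}$. -/

import Mathlib

open MeasureTheory ProbabilityTheory Filter Topology
open scoped ENNReal NNReal

namespace DelayedAcceptance

/-! ### The state space: a subset of `ℝ^d` with its Lebesgue-measurable sets -/

/-- `ℝ^d`, equipped with the `σ`-algebra of all Lebesgue-measurable sets. -/
abbrev LebesgueSpace (d : ℕ) : Type :=
  NullMeasurableSpace (EuclideanSpace ℝ (Fin d)) volume

/-- Lebesgue measure on a subset `X` of `ℝ^d`, as a measure on the type of points of `X` with the
`σ`-algebra of the traces on `X` of Lebesgue-measurable sets. -/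
noncomputable def lebesgueOn {d : ℕ} (X : Set (LebesgueSpace d)) : Measure X :=
  (Measure.completion (volume : Measure (EuclideanSpace ℝ (Fin d)))).comap Subtype.val

instance lebesgueOn.instSigmaFinite {d : ℕ} (X : Set (LebesgueSpace d)) :
    SigmaFinite (lebesgueOn X) := by
  obtain ⟨T, hTm, hTfin, hTun⟩ : ∃ T : ℕ → Set (EuclideanSpace ℝ (Fin d)),
      (∀ n, MeasurableSet (T n)) ∧ (∀ n, volume (T n) < ∞) ∧ ⋃ n, T n = Set.univ :=
    ⟨spanningSets volume, measurableSet_spanningSets _, measure_spanningSets_lt_top _,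
      iUnion_spanningSets _⟩
  set ν : Measure (LebesgueSpace d) :=
    Measure.completion (volume : Measure (EuclideanSpace ℝ (Fin d))) with hν
  by_cases h : Function.Injective (Subtype.val : X → LebesgueSpace d) ∧
      ∀ s : Set X, MeasurableSet s → NullMeasurableSet (Subtype.val '' s) ν
  · refine ⟨⟨⟨fun n => {x : X | x.1 ∈ T n}, fun _ => trivial, fun n => ?_, ?_⟩⟩⟩
    · have hm : @MeasurableSet (LebesgueSpace d) _ (T n) := (hTm n).nullMeasurableSet
      have hm' : MeasurableSet {x : X | x.1 ∈ T n} := measurable_subtype_coe hm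
      have h1 : lebesgueOn X {x : X | x.1 ∈ T n} =
          ν (Subtype.val '' {x : X | x.1 ∈ T n}) :=
        Measure.comap_apply₀ _ _ h.1 h.2 hm'.nullMeasurableSet
      have h2 : ν (Subtype.val '' {x : X | x.1 ∈ T n}) ≤ ν (T n) := by
        refine measure_mono ?_
        rintro _ ⟨x, hx, rfl⟩
        exact hx
      have h3 : ν (T n) = volume (T n) := by rw [hν, Measure.completion_apply]
      exact (h1.trans_le h2).trans_lt (h3 ▸ hTfin n)
    · ext x
      have hx : (x.1 : EuclideanSpace ℝ (Fin d)) ∈ ⋃ n, T n := by rw [hTun]; trivial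
      obtain ⟨n, hn⟩ := Set.mem_iUnion.1 hx
      exact ⟨fun _ => trivial, fun _ => Set.mem_iUnion.2 ⟨n, hn⟩⟩
  · have h0 : lebesgueOn X = 0 := dif_neg h
    rw [h0]
    infer_instance

/-! ### Stationary Markov chains and variance bounding -/

section Chains

variable {S : Type*} [MeasurableSpace S]

/-- The joint law of the first `n + 1` states `(X_0, …, X_n)` of the Markov chain with initial
distribution `π` and transition kernel `P`. -/
noncomputable def chainLaw (P : Kernel S S) (π : Measure S) :
    (n : ℕ) → Measure (Fin (n + 1) → S)
  | 0 => π.map fun x _ => x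
  | n + 1 =>
    (chainLaw P π n ⊗ₘ P.comap (fun x => x (Fin.last n)) (measurable_pi_apply _)).map
      fun z => Fin.snoc (α := fun _ => S) z.1 z.2

/-- `n * Var[(1/n) ∑ h(X_i)]`, where the sum is over the first `n` states of the chain started
from `π`; the number of states is `n + 1` here, so that it is never zero. -/
noncomputable def scaledVar (P : Kernel S S) (π : Measure S) (h : S → ℝ) (n : ℕ) : ℝ≥0∞ :=
  ((n + 1 : ℕ) : ℝ≥0∞) *
    eVar[fun x : Fin (n + 1) → S => ((n + 1 : ℕ) : ℝ)⁻¹ * ∑ i, h (x i); chainLaw P π n]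

/-- The asymptotic variance of `h` along the chain exists and equals `v`. -/
def HasAsymptoticVariance (P : Kernel S S) (π : Measure S) (h : S → ℝ) (v : ℝ≥0∞) : Prop :=
  Tendsto (scaledVar P π h) atTop (𝓝 v)

/-- `P` is variance bounding (with respect to `π`): every `h ∈ L²(π)` has a finite asymptotic
variance. -/
def VarianceBounding (P : Kernel S S) (π : Measure S) : Prop :=
  ∀ h : S → ℝ, MemLp h 2 π → ∃ v : ℝ≥0∞, v < ∞ ∧ HasAsymptoticVariance P π h v

/-! ### Propose-accept-reject kernels -/

/-- The kernel `q(x,y) α(x,y) μ(dy) + [1 - ᾱ(x)] δ_x(dy)`, where `ᾱ(x) = ∫ q(x,y) α(x,y) μ(dy)`,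
with proposal density `q` with respect to `μ` and acceptance probability `α`. -/
noncomputable def parKernel (μ : Measure S) [SFinite μ] (q : S → S → ℝ≥0)
    (α : S → S → ℝ≥0∞) : Kernel S S :=
  Kernel.withDensity (Kernel.const S μ) (fun x y => q x y * α x y) +
    Kernel.withDensity Kernel.id (fun x _ => 1 - ∫⁻ y, q x y * α x y ∂μ)

end Chains

section Ratios

variable {S : Type*}

/-- The ratio `r(x,y) = π(y) q(y,x) / (π(x) q(x,y))`, in `[0,∞]`. -/
noncomputable def rMH (π : S → ℝ≥0) (q : S → S → ℝ≥0) (x y : S) : ℝ≥0∞ :=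
  ((π y : ℝ≥0∞) * q y x) / ((π x : ℝ≥0∞) * q x y)

/-- The first-stage ratio `r₁(x,y) = π̂(y) q(y,x) / (π̂(x) q(x,y))`. -/
noncomputable def rDA₁ (πhat : S → ℝ≥0) (q : S → S → ℝ≥0) (x y : S) : ℝ≥0∞ :=
  ((πhat y : ℝ≥0∞) * q y x) / ((πhat x : ℝ≥0∞) * q x y)

/-- The second-stage ratio `r₂(x,y) = (π(y)/π̂(y)) / (π(x)/π̂(x))`. -/
noncomputable def rDA₂ (π πhat : S → ℝ≥0) (x y : S) : ℝ≥0∞ :=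
  ((π y : ℝ≥0∞) / πhat y) / ((π x : ℝ≥0∞) / πhat x)

/-- Metropolis-Hastings acceptance probability `1 ∧ r`. -/
noncomputable def alphaMH (π : S → ℝ≥0) (q : S → S → ℝ≥0) (x y : S) : ℝ≥0∞ :=
  min 1 (rMH π q x y)

/-- Delayed-acceptance acceptance probability `[1 ∧ r₁] [1 ∧ r₂]`. -/
noncomputable def alphaDA (π πhat : S → ℝ≥0) (q : S → S → ℝ≥0) (x y : S) : ℝ≥0∞ :=
  min 1 (rDA₁ πhat q x y) * min 1 (rDA₂ π πhat x y)

/-- The potential problem set `M_m(x) = {y | min(|log r₁(x,y)|, |log r₂(x,y)|) > m}`, with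
logarithms in `[-∞,∞]`. -/
def potentialProblemSet (π πhat : S → ℝ≥0) (q : S → S → ℝ≥0) (m : ℝ) (x : S) : Set S :=
  {y | (m : EReal) < ((min (ENNReal.log (rDA₁ πhat q x y)).abs
    (ENNReal.log (rDA₂ π πhat x y)).abs : ℝ≥0∞) : EReal)}

/-- The no problem set `C(x) = {y | sign(log r₁(x,y)) sign(log r₂(x,y)) ≥ 0}`. -/
def noProblemSet (π πhat : S → ℝ≥0) (q : S → S → ℝ≥0) (x : S) : Set S :=
  {y | 0 ≤ SignType.sign (ENNReal.log (rDA₁ πhat q x y)) *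
    SignType.sign (ENNReal.log (rDA₂ π πhat x y))}

end Ratios

section Kernels

variable {S : Type*} [MeasurableSpace S]

/-- The Metropolis-Hastings kernel with target density `π` and proposal density `q`. -/
noncomputable def kernelMH (μ : Measure S) [SFinite μ] (π : S → ℝ≥0) (q : S → S → ℝ≥0) :
    Kernel S S :=
  parKernel μ q (alphaMH π q)

/-- The delayed-acceptance kernel with target density `π`, approximation `π̂` and proposal
density `q`. -/
noncomputable def kernelDA (μ : Measure S) [SFinite μ] (π πhat : S → ℝ≥0) (q : S → S → ℝ≥0) :
    Kernel S S :=
  parKernel μ q (alphaDA π πhat q)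

/-- The probability distribution with density `π` with respect to `μ`. -/
noncomputable def target (μ : Measure S) (π : S → ℝ≥0) : Measure S :=
  μ.withDensity fun x => π x

end Kernels

end DelayedAcceptance

open DelayedAcceptance

/-! ### Contractions on a Hilbert space: bounded scaled variances versus a spectral gap. -/

section Hilbert

open scoped InnerProductSpace

variable {E : Type*} [NormedAddCommGroup E] [InnerProductSpace ℝ E]

/-! A reversible kernel is variance bounding exactly when it has a right spectral gap, `γ ‖f‖² ≤ ⟪f,
f - P f⟫` for mean-zero `f` (`varianceBounding_iff_gap`). Twice the right-hand side is the Dirichlet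
form, the integral of `(f x - f y)²` against the accepted flux `π(x) q(x,y) α(x,y)`; rejections sit
on the diagonal and contribute nothing. Gaps are therefore compared by comparing fluxes.

Where all densities involved are positive, `r = r₁ r₂`. If `log r₁` and `log r₂` do not have
opposite signs, then `1 ∧ r ≤ (1 ∧ r₁)(1 ∧ r₂)`; if one of them is at most `m` in absolute value,
the same holds up to a factor `exp |m|` (`min_one_mul_le_exp_mul`). So the MH flux is at most `exp
|m|` times the DA flux, except for proposals in `D(x)ᶜ`, of probability at most `ε`.

On the exceptional set `(f x - f y)² ≤ 2 f(x)² + 2 f(y)²`, and symmetry of the flux bounds the loss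
by `4 ε ‖f‖²`. The MH Dirichlet form is at least `2 γ ‖f‖²`, so a small `ε` leaves a gap for DA
(`VarianceBounding.of_flux_le`). -/

/-- The operator `∑_{i,j ≤ n} P^|i-j|`, whose quadratic form is the variance of the partial sums of
a stationary reversible chain. -/
noncomputable def sumVarOp (P : E →L[ℝ] E) : ℕ → E →L[ℝ] E
  | 0 => 1
  | n + 1 => sumVarOp P n + 1 + (2 : ℝ) • ∑ k ∈ Finset.range (n + 1), P ^ (k + 1)

theorem sum_pow_succ_mul_one_sub (P : E →L[ℝ] E) (n : ℕ) :
    (∑ k ∈ Finset.range n, P ^ (k + 1)) * (1 - P) = P - P ^ (n + 1) := by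
  induction n with
  | zero => simp
  | succ n ih =>
    rw [Finset.sum_range_succ, add_mul, ih, mul_sub, mul_one, ← pow_succ]
    abel

theorem sumVarOp_mul_one_sub (P : E →L[ℝ] E) (n : ℕ) :
    sumVarOp P n * (1 - P) =
      ((n + 1 : ℕ) : ℝ) • (1 + P) - (2 : ℝ) • ∑ k ∈ Finset.range (n + 1), P ^ (k + 1) := by
  induction n with
  | zero =>
    simp only [sumVarOp, one_mul, zero_add, Nat.cast_one, one_smul, Finset.range_one,
      Finset.sum_singleton, pow_one]
    module
  | succ n ih =>
    rw [sumVarOp, add_mul, add_mul, ih, smul_mul_assoc, sum_pow_succ_mul_one_sub, one_mul,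
      Finset.sum_range_succ _ (n + 1)]
    push_cast
    module

/-- The Poisson equation gives convergence of the scaled variances under a spectral gap. -/
theorem exists_tendsto_inner_sumVarOp [CompleteSpace E] (P : E →L[ℝ] E) (hP : ‖P‖ ≤ 1) {γ : ℝ}
    (hγ : 0 < γ) (hgap : ∀ f : E, γ * ‖f‖ ^ 2 ≤ ⟪f, f - P f⟫_ℝ) (f : E) :
    ∃ v : ℝ, Tendsto (fun n : ℕ => ⟪f, sumVarOp P n f⟫_ℝ / ((n + 1 : ℕ) : ℝ)) atTop (𝓝 v) := by
  -- The gap makes `1 - P` coercive, hence invertible. Solving the Poisson equation twice, `f = (1 -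
  -- P)² g'`, lets the double sum telescope twice.
  have hunit : IsUnit (1 - P) := by
    refine ContinuousLinearMap.isUnit_of_forall_le_norm_inner_map (1 - P) (c := ⟨γ, hγ.le⟩) hγ ?_
    intro x
    refine le_trans ?_ (le_abs_self _)
    rw [real_inner_comm, mul_comm]
    exact hgap x
  obtain ⟨u, hu⟩ := hunit
  have hsurj : ∀ y, ∃ x, (1 - P) x = y := fun y => by
    refine ⟨(↑u⁻¹ : E →L[ℝ] E) y, ?_⟩
    rw [← hu, ← mul_apply_eq_comp, Units.mul_inv, one_apply_eq_self]
  obtain ⟨g, rfl⟩ := hsurj f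
  obtain ⟨g', rfl⟩ := hsurj g
  set f := (1 - P) ((1 - P) g') with hf
  set g := (1 - P) g' with hg
  refine ⟨⟪f, (1 + P) g⟫_ℝ, ?_⟩
  have key : ∀ n : ℕ, ⟪f, sumVarOp P n f⟫_ℝ / ((n + 1 : ℕ) : ℝ) =
      ⟪f, (1 + P) g⟫_ℝ - ((n + 1 : ℕ) : ℝ)⁻¹ * (2 * ⟪f, P g' - (P ^ (n + 2)) g'⟫_ℝ) := by
    intro n
    have h1 : sumVarOp P n f = ((n + 1 : ℕ) : ℝ) • (1 + P) g -
        (2 : ℝ) • (P g' - (P ^ (n + 2)) g') := by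
      have := congrArg (fun T : E →L[ℝ] E => T g) (sumVarOp_mul_one_sub P n)
      have h2 := congrArg (fun T : E →L[ℝ] E => T g') (sum_pow_succ_mul_one_sub P (n + 1))
      simp only [mul_apply_eq_comp, sub_apply, smul_apply] at this h2
      refine (show sumVarOp P n f = _ from this).trans ?_
      rw [← show (∑ k ∈ Finset.range (n + 1), P ^ (k + 1)) g = P g' - (P ^ (n + 2)) g' from h2]
    rw [h1, inner_sub_right, real_inner_smul_right, real_inner_smul_right]
    have : ((n + 1 : ℕ) : ℝ) ≠ 0 := by positivity
    field_simp
  simp_rw [key]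
  -- The remainder involves only powers of a contraction applied to `g'`, so it stays bounded and
  -- division by `n + 1` kills it.
  have hlim : Tendsto (fun n : ℕ => ((n + 1 : ℕ) : ℝ)⁻¹ *
      (2 * ⟪f, P g' - (P ^ (n + 2)) g'⟫_ℝ)) atTop (𝓝 0) := by
    refine Tendsto.zero_mul_isBoundedUnder_le
      ((tendsto_inv_atTop_nhds_zero_nat (𝕜 := ℝ)).comp (tendsto_add_atTop_nat 1)) ?_
    refine isBoundedUnder_of ⟨2 * (‖f‖ * (‖g'‖ + ‖g'‖)), fun n => ?_⟩
    have hpow : ∀ k : ℕ, ‖(P ^ k) g'‖ ≤ ‖g'‖ := fun k => by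
      refine ((P ^ k).le_opNorm g').trans (mul_le_of_le_one_left (norm_nonneg _) ?_)
      rcases Nat.eq_zero_or_pos k with rfl | hk
      · rw [pow_zero]; exact ContinuousLinearMap.norm_id_le
      · exact (norm_pow_le' P hk).trans (pow_le_one₀ (norm_nonneg _) hP)
    simp only [Function.comp, norm_mul, Real.norm_ofNat]
    gcongr
    refine (norm_inner_le_norm _ _).trans ?_
    gcongr
    refine (norm_sub_le _ _).trans (add_le_add ?_ (hpow _))
    simpa using hpow 1
  simpa using tendsto_const_nhds.sub hlim

theorem norm_pow_sub_self_le (P : E →L[ℝ] E) (hP : ‖P‖ ≤ 1) (f : E) (k : ℕ) :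
    ‖(P ^ k) f - f‖ ≤ k * ‖f - P f‖ := by
  induction k with
  | zero => simp
  | succ k ih =>
    have h1 : (P ^ (k + 1)) f - f = P ((P ^ k) f - f) + (P f - f) := by
      rw [pow_succ', mul_apply_eq_comp, map_sub]; abel
    rw [h1]
    refine (norm_add_le _ _).trans ?_
    have h2 : ‖P ((P ^ k) f - f)‖ ≤ ‖(P ^ k) f - f‖ :=
      (P.le_opNorm _).trans (mul_le_of_le_one_left (norm_nonneg _) hP)
    rw [norm_sub_rev (P f) f, Nat.cast_add, Nat.cast_one]
    linarith

/-- If `f` is nearly invariant, all `(n + 1)²` terms `⟪f, P^|i-j| f⟫` are close to `‖f‖²`, each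
losing at most `|i-j| ‖f‖ ‖f - P f‖`. Quadratic growth then conflicts with a linear variance bound.
The cubic constant is crude. -/
theorem le_inner_sumVarOp (P : E →L[ℝ] E) (hP : ‖P‖ ≤ 1) (f : E) (n : ℕ) :
    ((n : ℝ) + 1) ^ 2 * ‖f‖ ^ 2 - 2 * ((n : ℝ) + 1) ^ 3 * (‖f‖ * ‖f - P f‖) ≤
      ⟪f, sumVarOp P n f⟫_ℝ := by
  have hd : 0 ≤ ‖f‖ * ‖f - P f‖ := by positivity
  have hk : ∀ k : ℕ, ‖f‖ ^ 2 - k * (‖f‖ * ‖f - P f‖) ≤ ⟪f, (P ^ k) f⟫_ℝ := fun k => by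
    have h1 : ⟪f, (P ^ k) f⟫_ℝ = ‖f‖ ^ 2 + ⟪f, (P ^ k) f - f⟫_ℝ := by
      rw [inner_sub_right, real_inner_self_eq_norm_sq]; ring
    have h2 := neg_le_of_abs_le (abs_real_inner_le_norm f ((P ^ k) f - f))
    have h3 := mul_le_mul_of_nonneg_left (norm_pow_sub_self_le P hP f k) (norm_nonneg f)
    linarith
  induction n with
  | zero =>
    simp only [sumVarOp, one_apply_eq_self, real_inner_self_eq_norm_sq]
    norm_num
    positivity
  | succ n ih =>
    simp only [sumVarOp, add_apply, smul_apply,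
      inner_add_right, real_inner_smul_right, one_apply_eq_self,
      real_inner_self_eq_norm_sq, sum_apply, inner_sum]
    have hs : ((n : ℝ) + 1) * (‖f‖ ^ 2 - ((n : ℝ) + 1) * (‖f‖ * ‖f - P f‖)) ≤
        ∑ k ∈ Finset.range (n + 1), ⟪f, (P ^ (k + 1)) f⟫_ℝ := by
      have := Finset.card_nsmul_le_sum (Finset.range (n + 1))
        (fun k => ⟪f, (P ^ (k + 1)) f⟫_ℝ) (‖f‖ ^ 2 - ((n : ℝ) + 1) * (‖f‖ * ‖f - P f‖)) ?_
      · simpa using this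
      · intro k hkn
        refine le_trans ?_ (hk (k + 1))
        have : ((k + 1 : ℕ) : ℝ) ≤ (n : ℝ) + 1 := by
          have := Finset.mem_range.1 hkn
          exact_mod_cast this
        gcongr
    rw [Nat.cast_add, Nat.cast_one]
    nlinarith [mul_nonneg (Nat.cast_nonneg (α := ℝ) n) hd,
      mul_nonneg (sq_nonneg (n : ℝ)) hd]

theorem sumVarOp_symm (P : E →L[ℝ] E) (hsymm : ∀ f g : E, ⟪P f, g⟫_ℝ = ⟪f, P g⟫_ℝ) (n : ℕ)
    (f g : E) : ⟪sumVarOp P n f, g⟫_ℝ = ⟪f, sumVarOp P n g⟫_ℝ := by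
  have hpow : ∀ k : ℕ, ∀ f g : E, ⟪(P ^ k) f, g⟫_ℝ = ⟪f, (P ^ k) g⟫_ℝ := fun k => by
    induction k with
    | zero => simp
    | succ k ih =>
      intro f g
      rw [pow_succ, mul_apply_eq_comp, ih, hsymm, ← mul_apply_eq_comp,
        ← pow_succ', pow_succ]
  induction n with
  | zero => simp [sumVarOp]
  | succ n ih =>
    simp only [sumVarOp, add_apply, smul_apply,
      inner_add_right, real_inner_smul_right, one_apply_eq_self, inner_add_left,
      real_inner_smul_left, sum_apply, inner_sum, sum_inner, hpow, ih]

/-- Pointwise boundedness of the scaled variances forces a spectral gap. -/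
theorem exists_gap_of_bounded_inner_sumVarOp [CompleteSpace E] (P : E →L[ℝ] E) (hP : ‖P‖ ≤ 1)
    (hsymm : ∀ f g : E, ⟪P f, g⟫_ℝ = ⟪f, P g⟫_ℝ)
    (hpos : ∀ (f : E) (n : ℕ), 0 ≤ ⟪f, sumVarOp P n f⟫_ℝ)
    (hbdd : ∀ f : E, ∃ C : ℝ, ∀ n : ℕ, ⟪f, sumVarOp P n f⟫_ℝ ≤ C * ((n : ℝ) + 1)) :
    ∃ γ : ℝ, 0 < γ ∧ ∀ f : E, γ * ‖f‖ ^ 2 ≤ ⟪f, f - P f⟫_ℝ := by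
  choose C hC using hbdd
  set T : ℕ → E →L[ℝ] E := fun n => ((n : ℝ) + 1)⁻¹ • sumVarOp P n with hT
  -- Nonnegativity of the form at `f ± g` controls the mixed term by the diagonal ones. This gives
  -- weak boundedness of `T n g`; two uses of Banach–Steinhaus turn it into a uniform bound on `‖T
  -- n‖`.
  have hpolar : ∀ n (f g : E), |⟪sumVarOp P n g, f⟫_ℝ| ≤ (C f + C g) * ((n : ℝ) + 1) := by
    intro n f g
    have h1 := hpos (f + g) n
    have h2 := hpos (f - g) n
    have h3 := sumVarOp_symm P hsymm n f g
    simp only [map_add, map_sub, inner_add_left, inner_add_right, inner_sub_left,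
      inner_sub_right] at h1 h2
    have h4 := hC f n
    have h5 := hC g n
    have h6 := hpos f n
    have h7 := hpos g n
    rw [real_inner_comm] at h3
    rw [real_inner_comm]
    have h8 : ⟪g, sumVarOp P n f⟫_ℝ = ⟪f, sumVarOp P n g⟫_ℝ := h3
    rw [h8] at h1 h2
    rw [abs_le]
    constructor <;> linarith
  have hTf : ∀ g : E, ∃ K, ∀ n, ‖T n g‖ ≤ K := by
    intro g
    obtain ⟨K, hK⟩ := banach_steinhaus (g := fun n => innerSL ℝ (T n g)) (fun f => by
      refine ⟨C f + C g, fun n => ?_⟩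
      have hn : (0 : ℝ) < (n : ℝ) + 1 := by positivity
      simp only [hT, innerSL_apply_apply, smul_apply, real_inner_smul_left,
        norm_mul, norm_inv, Real.norm_eq_abs, abs_of_pos hn]
      rw [inv_mul_le_iff₀ hn, mul_comm]
      exact hpolar n f g)
    exact ⟨K, fun n => by simpa using hK n⟩
  obtain ⟨K, hK⟩ := banach_steinhaus hTf
  obtain ⟨n, hn⟩ := exists_nat_ge (K : ℝ)
  have hN : (0 : ℝ) < (n : ℝ) + 1 := by positivity
  -- With `n ≥ K`, the upper bound `n (n + 1) ‖f‖²` falls short of `(n + 1)² ‖f‖²` by `(n + 1)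
  -- ‖f‖²`, forcing `‖f‖ ≤ 2 (n + 1)² ‖f - P f‖`. Squaring and `‖f - P f‖² ≤ 2 ⟪f, f - P f⟫` give
  -- the constant.
  refine ⟨(8 * ((n : ℝ) + 1) ^ 4)⁻¹, by positivity, fun f => ?_⟩
  have h1 : ⟪f, sumVarOp P n f⟫_ℝ ≤ n * ((n : ℝ) + 1) * ‖f‖ ^ 2 := by
    have h2 : sumVarOp P n f = ((n : ℝ) + 1) • T n f := by
      simp [hT, smul_smul, hN.ne']
    rw [h2, real_inner_smul_right]
    have h3 : ⟪f, T n f⟫_ℝ ≤ ‖f‖ * (n * ‖f‖) := by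
      refine (real_inner_le_norm _ _).trans ?_
      gcongr
      refine ((T n).le_opNorm f).trans ?_
      gcongr
      exact (hK n).trans hn
    nlinarith
  have h2 := le_inner_sumVarOp P hP f n
  have h3 : ‖f‖ ≤ 2 * ((n : ℝ) + 1) ^ 2 * ‖f - P f‖ := by
    rcases (norm_nonneg f).eq_or_lt with h0 | h0
    · rw [← h0]; positivity
    · have : (n + 1 : ℝ) * ‖f‖ * ‖f‖ ≤ (n + 1 : ℝ) * ‖f‖ * (2 * ((n : ℝ) + 1) ^ 2 * ‖f - P f‖) := by
        nlinarith
      exact le_of_mul_le_mul_left this (by positivity)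
  have h4 : ‖f - P f‖ ^ 2 ≤ 2 * ⟪f, f - P f⟫_ℝ := by
    have h5 : ‖P f‖ ≤ ‖f‖ := (P.le_opNorm f).trans (mul_le_of_le_one_left (norm_nonneg _) hP)
    rw [norm_sub_sq_real, inner_sub_right, real_inner_self_eq_norm_sq]
    nlinarith [norm_nonneg (P f)]
  rw [inv_mul_le_iff₀ (by positivity)]
  calc ‖f‖ ^ 2 ≤ (2 * ((n : ℝ) + 1) ^ 2 * ‖f - P f‖) ^ 2 := by gcongr
    _ = 4 * ((n : ℝ) + 1) ^ 4 * ‖f - P f‖ ^ 2 := by ring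
    _ ≤ 4 * ((n : ℝ) + 1) ^ 4 * (2 * ⟪f, f - P f⟫_ℝ) := by gcongr
    _ = _ := by ring

end Hilbert

/-! ### The operator of a reversible kernel on `L²(π)` and its Dirichlet form. -/

section KernelOperator

open scoped InnerProductSpace

variable {S : Type*} [MeasurableSpace S]

theorem measurePreserving_fst_compProd (π : Measure S) [IsProbabilityMeasure π] (P : Kernel S S)
    [IsMarkovKernel P] : MeasurePreserving Prod.fst (π ⊗ₘ P) π :=
  ⟨measurable_fst, Measure.fst_compProd π P⟩

theorem measurePreserving_snd_compProd {π : Measure S} [IsProbabilityMeasure π] {P : Kernel S S}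
    [IsMarkovKernel P] (hrev : (π ⊗ₘ P).map Prod.swap = π ⊗ₘ P) :
    MeasurePreserving Prod.snd (π ⊗ₘ P) π := by
  refine ⟨measurable_snd, ?_⟩
  nth_rw 1 [← hrev]
  rw [Measure.map_map measurable_snd measurable_swap]
  exact Measure.fst_compProd π P

/-- The operator `f ↦ ∫ f(y) P(·,dy)` on `L²(π)`, for a kernel `P` reversible with respect to `π`. -/
noncomputable def kernelOp {π : Measure S} [IsProbabilityMeasure π] {P : Kernel S S}
    [IsMarkovKernel P] (hrev : (π ⊗ₘ P).map Prod.swap = π ⊗ₘ P) : Lp ℝ 2 π →L[ℝ] Lp ℝ 2 π :=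
  -- The pullbacks along both coordinates embed `L²(π)` isometrically in `L²(π ⊗ₘ P)`. Taking `J₁*
  -- J₂` makes the contraction bound immediate and avoids choosing representatives.
  (ContinuousLinearMap.adjoint (Lp.compMeasurePreservingₗᵢ (E := ℝ) (p := 2) ℝ Prod.fst
    (measurePreserving_fst_compProd π P)).toContinuousLinearMap).comp
  (Lp.compMeasurePreservingₗᵢ (E := ℝ) (p := 2) ℝ Prod.snd
    (measurePreserving_snd_compProd hrev)).toContinuousLinearMap

variable {π : Measure S} [IsProbabilityMeasure π] {P : Kernel S S} [IsMarkovKernel P]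
  (hrev : (π ⊗ₘ P).map Prod.swap = π ⊗ₘ P)

theorem inner_kernelOp_eq_inner (f g : Lp ℝ 2 π) :
    ⟪f, kernelOp hrev g⟫_ℝ =
      ⟪Lp.compMeasurePreservingₗᵢ (E := ℝ) (p := 2) ℝ Prod.fst
        (measurePreserving_fst_compProd π P) f,
      Lp.compMeasurePreservingₗᵢ (E := ℝ) (p := 2) ℝ Prod.snd
        (measurePreserving_snd_compProd hrev) g⟫_ℝ := by
  simp only [kernelOp, ContinuousLinearMap.comp_apply, ContinuousLinearMap.adjoint_inner_right]
  rfl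

theorem norm_kernelOp_le : ‖kernelOp hrev‖ ≤ 1 := by
  refine (ContinuousLinearMap.opNorm_comp_le _ _).trans ?_
  rw [LinearIsometryEquiv.norm_map]
  exact mul_le_one₀ (LinearIsometry.norm_toContinuousLinearMap_le _) (norm_nonneg _)
    (LinearIsometry.norm_toContinuousLinearMap_le _)

theorem inner_kernelOp (f g : Lp ℝ 2 π) :
    ⟪f, kernelOp hrev g⟫_ℝ = ∫ z, f z.1 * g z.2 ∂(π ⊗ₘ P) := by
  rw [inner_kernelOp_eq_inner, L2.inner_def]
  refine integral_congr_ae ?_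
  filter_upwards [Lp.coeFn_compMeasurePreserving f (measurePreserving_fst_compProd π P),
    Lp.coeFn_compMeasurePreserving g (measurePreserving_snd_compProd hrev)] with z h1 h2
  simp only [Lp.compMeasurePreservingₗᵢ, LinearIsometry.coe_mk, Lp.compMeasurePreservingₗ,
    LinearMap.coe_mk, AddHom.coe_mk] at *
  erw [h1, h2]
  simp [mul_comm]

theorem kernelOp_symm (f g : Lp ℝ 2 π) :
    ⟪kernelOp hrev f, g⟫_ℝ = ⟪f, kernelOp hrev g⟫_ℝ := by
  rw [real_inner_comm, inner_kernelOp, inner_kernelOp]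
  nth_rw 1 [← hrev]
  rw [(MeasurableEquiv.prodComm (α := S) (β := S)).measurableEmbedding.integral_map
    (f := Prod.swap)]
  simp [mul_comm]

theorem integrable_mul_fst_snd {f g : S → ℝ} (hf : MemLp f 2 π) (hg : MemLp g 2 π)
    (hrev : (π ⊗ₘ P).map Prod.swap = π ⊗ₘ P) :
    Integrable (fun z : S × S => f z.1 * g z.2) (π ⊗ₘ P) :=
  (hf.comp_measurePreserving (measurePreserving_fst_compProd π P)).integrable_mul
    (hg.comp_measurePreserving (measurePreserving_snd_compProd hrev))

theorem kernelOp_ae_eq (g : Lp ℝ 2 π) :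
    kernelOp hrev g =ᵐ[π] fun x => ∫ y, g y ∂(P x) := by
  have hint : Integrable (fun z : S × S => g z.2) (π ⊗ₘ P) :=
    ((Lp.memLp g).comp_measurePreserving
      (measurePreserving_snd_compProd hrev)).integrable one_le_two
  refine Integrable.ae_eq_of_forall_setIntegral_eq _ _ ((Lp.memLp _).integrable one_le_two)
    (Integrable.integral_compProd (κ := Kernel.const Unit π)
      (η := Kernel.prodMkLeft Unit P) (a := ()) hint) fun s hs _ => ?_
  have h1 := L2.inner_indicatorConstLp_one (𝕜 := ℝ) hs (measure_ne_top π s) (kernelOp hrev g)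
  rw [← h1, inner_kernelOp]
  have h2 : ∫ z, (indicatorConstLp 2 hs (measure_ne_top π s) (1 : ℝ)) z.1 * g z.2 ∂(π ⊗ₘ P) =
      ∫ z, s.indicator (fun _ => (1 : ℝ)) z.1 * g z.2 ∂(π ⊗ₘ P) := by
    refine integral_congr_ae ?_
    have := (measurePreserving_fst_compProd π P).quasiMeasurePreserving.ae_eq_comp
      (indicatorConstLp_coeFn (p := 2) (hs := hs) (hμs := measure_ne_top π s) (c := (1 : ℝ)))
    filter_upwards [this] with z hz
    simp only [Function.comp] at hz
    rw [hz]
  rw [h2, Measure.integral_compProd (integrable_mul_fst_snd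
    ((memLp_const (1 : ℝ)).indicator hs) (Lp.memLp g) hrev), ← integral_indicator hs]
  congr 1 with x
  by_cases hx : x ∈ s <;> simp [hx]

/-- The Dirichlet form. -/
theorem lintegral_sub_sq_eq (f : Lp ℝ 2 π) :
    ∫⁻ z, ‖f z.1 - f z.2‖ₑ ^ 2 ∂(π ⊗ₘ P) =
      ENNReal.ofReal (2 * ⟪f, f - kernelOp hrev f⟫_ℝ) := by
  set J₁ := Lp.compMeasurePreservingₗᵢ (E := ℝ) (p := 2) ℝ Prod.fst
    (measurePreserving_fst_compProd π P) with hJ₁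
  set J₂ := Lp.compMeasurePreservingₗᵢ (E := ℝ) (p := 2) ℝ Prod.snd
    (measurePreserving_snd_compProd hrev) with hJ₂
  -- Both marginals are `π`, so both squares contribute `‖f‖²`.
  have h1 : ‖J₁ f - J₂ f‖ ^ 2 = 2 * ⟪f, f - kernelOp hrev f⟫_ℝ := by
    rw [norm_sub_sq_real, LinearIsometry.norm_map, LinearIsometry.norm_map, inner_sub_right,
      inner_kernelOp_eq_inner, real_inner_self_eq_norm_sq]
    ring
  rw [← h1, ← real_inner_self_eq_norm_sq, L2.inner_def,
    ofReal_integral_eq_lintegral_ofReal (L2.integrable_inner _ _)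
      (ae_of_all _ fun _ => real_inner_self_nonneg)]
  refine lintegral_congr_ae ?_
  filter_upwards [Lp.coeFn_compMeasurePreserving f (measurePreserving_fst_compProd π P),
    Lp.coeFn_compMeasurePreserving f (measurePreserving_snd_compProd hrev),
    Lp.coeFn_sub (J₁ f) (J₂ f)] with z h2 h3 h4
  have h5 : (J₁ f) z = f z.1 := h2
  have h6 : (J₂ f) z = f z.2 := h3
  rw [h4, Pi.sub_apply, h5, h6, real_inner_self_eq_norm_sq, ENNReal.ofReal_pow (norm_nonneg _),
    ofReal_norm]

end KernelOperator

/-! ### Covariances along the stationary chain. -/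

section Chain

open scoped InnerProductSpace

variable {S : Type*} [MeasurableSpace S]

theorem measurable_finSnoc (n : ℕ) : Measurable fun z : (Fin n → S) × S =>
    Fin.snoc (α := fun _ => S) z.1 z.2 := by
  refine measurable_pi_iff.2 fun i => ?_
  induction i using Fin.lastCases with
  | last => simpa using measurable_snd
  | cast j =>
    simp only [Fin.snoc_castSucc]
    exact (measurable_pi_apply j).comp measurable_fst

/-- With `Ω` the past and `X` its current state, the current and next states have law `π ⊗ₘ P`; this
reduces path statements to two-step ones. -/
theorem MeasureTheory.MeasurePreserving.prodMap_compProd_comap {Ω : Type*} [MeasurableSpace Ω]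
    {ν : Measure Ω} [SFinite ν] {π : Measure S} [SFinite π] {P : Kernel S S} [IsSFiniteKernel P]
    {X : Ω → S} (hX : MeasurePreserving X ν π) :
    MeasurePreserving (Prod.map X id) (ν ⊗ₘ P.comap X hX.measurable) (π ⊗ₘ P) := by
  refine ⟨hX.measurable.prodMap measurable_id, ?_⟩
  ext s hs
  rw [Measure.map_apply (hX.measurable.prodMap measurable_id) hs,
    Measure.compProd_apply (hX.measurable.prodMap measurable_id hs), Measure.compProd_apply hs,
    ← hX.lintegral_comp (Kernel.measurable_kernel_prodMk_left hs)]
  rfl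

theorem MeasureTheory.MeasurePreserving.integral_comp_of_aestronglyMeasurable {α β : Type*}
    [MeasurableSpace α] [MeasurableSpace β] {μ : Measure α} {ν : Measure β} {φ : α → β}
    (hφ : MeasurePreserving φ μ ν) {g : β → ℝ} (hg : AEStronglyMeasurable g ν) :
    ∫ x, g (φ x) ∂μ = ∫ y, g y ∂ν := by
  have hg' := hg
  rw [← hφ.map_eq] at hg'
  rw [← integral_map hφ.measurable.aemeasurable hg', hφ.map_eq]

theorem measurePreserving_finSnoc_chainLaw (P : Kernel S S) (π : Measure S) (n : ℕ) :
    MeasurePreserving (fun z : (Fin (n + 1) → S) × S => Fin.snoc (α := fun _ => S) z.1 z.2)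
      (chainLaw P π n ⊗ₘ P.comap (fun x => x (Fin.last n)) (measurable_pi_apply _))
      (chainLaw P π (n + 1)) :=
  ⟨measurable_finSnoc _, rfl⟩

variable {π : Measure S} [IsProbabilityMeasure π] {P : Kernel S S} [IsMarkovKernel P]

instance isProbabilityMeasure_chainLaw (n : ℕ) : IsProbabilityMeasure (chainLaw P π n) := by
  induction n with
  | zero => exact Measure.isProbabilityMeasure_map (by fun_prop)
  | succ n ih => exact Measure.isProbabilityMeasure_map (measurable_finSnoc _).aemeasurable

theorem measurePreserving_eval_chainLaw (hrev : (π ⊗ₘ P).map Prod.swap = π ⊗ₘ P) (n : ℕ)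
    (i : Fin (n + 1)) :
    MeasurePreserving (fun x : Fin (n + 1) → S => x i) (chainLaw P π n) π := by
  induction n with
  | zero =>
    refine ⟨measurable_pi_apply i, ?_⟩
    rw [chainLaw, Measure.map_map (measurable_pi_apply i) (by fun_prop)]
    exact Measure.map_id
  | succ n ih =>
    refine ⟨measurable_pi_apply i, ?_⟩
    rw [chainLaw, Measure.map_map (measurable_pi_apply i) (measurable_finSnoc _)]
    induction i using Fin.lastCases with
    | last =>
      have := (measurePreserving_snd_compProd hrev).comp
        ((ih (Fin.last n)).prodMap_compProd_comap (P := P))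
      simpa [Function.comp_def] using this.map_eq
    | cast j =>
      have : (fun x : Fin (n + 1 + 1) → S => x j.castSucc) ∘
          (fun z : (Fin (n + 1) → S) × S => Fin.snoc (α := fun _ => S) z.1 z.2) =
          (fun x => x j) ∘ Prod.fst := by ext; simp
      rw [this, ← Measure.map_map (measurable_pi_apply j) measurable_fst]
      exact (congrArg _ (Measure.fst_compProd _ _)).trans (ih j).map_eq

variable (hrev : (π ⊗ₘ P).map Prod.swap = π ⊗ₘ P)

/-- The Markov property, tested against a square-integrable function of the past. -/
theorem integral_mul_compProd_comap {Ω : Type*} [MeasurableSpace Ω] {ν : Measure Ω}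
    [IsProbabilityMeasure ν] {X : Ω → S} (hX : MeasurePreserving X ν π) {φ : Ω → ℝ}
    (hφ : MemLp φ 2 ν) (g : Lp ℝ 2 π) :
    ∫ z, φ z.1 * g z.2 ∂(ν ⊗ₘ P.comap X hX.measurable) =
      ∫ ω, φ ω * kernelOp hrev g (X ω) ∂ν := by
  have hfst : MeasurePreserving Prod.fst (ν ⊗ₘ P.comap X hX.measurable) ν :=
    ⟨measurable_fst, Measure.fst_compProd _ _⟩
  have hsnd := (measurePreserving_snd_compProd hrev).comp (hX.prodMap_compProd_comap (P := P))
  have hint : Integrable (fun z => φ z.1 * g z.2) (ν ⊗ₘ P.comap X hX.measurable) :=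
    (hφ.comp_measurePreserving hfst).integrable_mul ((Lp.memLp g).comp_measurePreserving hsnd)
  rw [Measure.integral_compProd hint]
  refine integral_congr_ae ?_
  filter_upwards [hX.quasiMeasurePreserving.ae_eq_comp (kernelOp_ae_eq hrev g)] with ω hω
  simp only [Function.comp] at hω
  rw [hω, integral_const_mul, Kernel.comap_apply]

/-- Integrating out the last state replaces `g` by `P g` and shortens the path by one, which is why
the induction varies `g`. -/
theorem integral_mul_chainLaw (f g : Lp ℝ 2 π) (n : ℕ) (i : Fin (n + 1)) :
    ∫ x, f (x i) * g (x (Fin.last n)) ∂(chainLaw P π n) =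
      ⟪f, (kernelOp hrev ^ (n - i : ℕ)) g⟫_ℝ := by
  have hself : ∀ (n : ℕ) (g : Lp ℝ 2 π),
      ∫ x, f (x (Fin.last n)) * g (x (Fin.last n)) ∂(chainLaw P π n) = ⟪f, g⟫_ℝ := by
    intro n g
    have h := measurePreserving_eval_chainLaw hrev n (Fin.last n)
    rw [h.integral_comp_of_aestronglyMeasurable (g := fun x => f x * g x)
      ((Lp.aestronglyMeasurable f).mul (Lp.aestronglyMeasurable g)), L2.inner_def]
    simp [mul_comm]
  induction n generalizing g with
  | zero =>
    obtain rfl : i = Fin.last 0 := Fin.ext (by omega)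
    rw [hself]
    simp
  | succ n ih =>
    induction i using Fin.lastCases with
    | last => rw [hself]; simp
    | cast j =>
      have h1 := measurePreserving_eval_chainLaw hrev (n + 1) j.castSucc
      have h2 := measurePreserving_eval_chainLaw hrev (n + 1) (Fin.last (n + 1))
      have hm : AEStronglyMeasurable (fun x => f (x j.castSucc) * g (x (Fin.last (n + 1))))
          (chainLaw P π (n + 1)) :=
        ((Lp.memLp f).comp_measurePreserving h1).1.mul ((Lp.memLp g).comp_measurePreserving h2).1
      rw [← (measurePreserving_finSnoc_chainLaw P π n).integral_comp_of_aestronglyMeasurable hm]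
      simp only [Fin.snoc_castSucc, Fin.snoc_last]
      have h4 := integral_mul_compProd_comap hrev
        (measurePreserving_eval_chainLaw hrev n (Fin.last n))
        ((Lp.memLp f).comp_measurePreserving (measurePreserving_eval_chainLaw hrev n j)) g
      simp only [Function.comp] at h4
      rw [h4, ih, ← mul_apply_eq_comp, ← pow_succ]
      have : (j : ℕ) < n + 1 := j.2
      congr 4
      rw [Fin.val_castSucc]
      omega

theorem integral_sum_sq_chainLaw (h : Lp ℝ 2 π) (n : ℕ) :
    ∫ x, (∑ i, h (x i)) ^ 2 ∂(chainLaw P π n) = ⟪h, sumVarOp (kernelOp hrev) n h⟫_ℝ := by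
  have hmem : ∀ n i, MemLp (fun x : Fin (n + 1) → S => h (x i)) 2 (chainLaw P π n) := fun n i =>
    (Lp.memLp h).comp_measurePreserving (measurePreserving_eval_chainLaw hrev n i)
  induction n with
  | zero =>
    have := integral_mul_chainLaw hrev h h 0 0
    simpa [sumVarOp, pow_two] using this
  | succ n ih =>
    have h1 : ∀ x : Fin (n + 1 + 1) → S, (∑ i, h (x i)) ^ 2 = (∑ i : Fin (n + 1), h (x i.castSucc)) ^ 2 +
        h (x (Fin.last (n + 1))) * h (x (Fin.last (n + 1))) +
        2 * ∑ i : Fin (n + 1), h (x i.castSucc) * h (x (Fin.last (n + 1))) := by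
      intro x
      rw [Fin.sum_univ_castSucc, ← Finset.sum_mul]
      ring
    have hint : ∀ i, Integrable (fun x : Fin (n + 1 + 1) → S => h (x i) * h (x (Fin.last (n + 1))))
        (chainLaw P π (n + 1)) := fun i => (hmem _ i).integrable_mul (hmem _ _)
    have hS : MemLp (fun x : Fin (n + 1 + 1) → S => ∑ i : Fin (n + 1), h (x i.castSucc)) 2
        (chainLaw P π (n + 1)) := memLp_finsetSum _ fun i _ => hmem _ _
    simp_rw [h1]
    have hsum : Integrable (fun x : Fin (n + 1 + 1) → S => ∑ i : Fin (n + 1),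
        h (x i.castSucc) * h (x (Fin.last (n + 1)))) (chainLaw P π (n + 1)) :=
      integrable_finsetSum _ fun i _ => hint _
    have hadd : Integrable (fun x : Fin (n + 1 + 1) → S => (∑ i : Fin (n + 1), h (x i.castSucc)) ^ 2 +
        h (x (Fin.last (n + 1))) * h (x (Fin.last (n + 1)))) (chainLaw P π (n + 1)) :=
      hS.integrable_sq.add (hint _)
    rw [integral_add hadd (hsum.const_mul 2),
      integral_add hS.integrable_sq (hint _), integral_const_mul,
      integral_finsetSum _ fun i _ => hint _]
    simp_rw [integral_mul_chainLaw hrev]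
    have hfst : ∫ x, (∑ i : Fin (n + 1), h (x i.castSucc)) ^ 2 ∂(chainLaw P π (n + 1)) =
        ⟪h, sumVarOp (kernelOp hrev) n h⟫_ℝ := by
      rw [← ih]
      rw [← (measurePreserving_finSnoc_chainLaw P π n).integral_comp_of_aestronglyMeasurable
        hS.integrable_sq.1]
      simp only [Fin.snoc_castSucc]
      have hS' : MemLp (fun x : Fin (n + 1) → S => ∑ i : Fin (n + 1), h (x i)) 2
        (chainLaw P π n) := memLp_finsetSum _ fun i _ => hmem _ _
      exact MeasurePreserving.integral_comp_of_aestronglyMeasurable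
        ⟨measurable_fst, Measure.fst_compProd _ _⟩ hS'.integrable_sq.1
    rw [hfst, sumVarOp, add_apply, add_apply, inner_add_right, inner_add_right, smul_apply,
      real_inner_smul_right, sum_apply, inner_sum]
    congr 2
    · simp
    -- The lags `n + 1 - i` run through `1, …, n + 1`; reflecting the sum matches the recursion of
    -- `sumVarOp`.
    · have := Fin.sum_univ_eq_sum_range
        (fun k => ⟪h, (kernelOp hrev ^ (n + 1 - k)) h⟫_ℝ) (n + 1)
      simp only [Fin.val_castSucc]
      rw [this, ← Finset.sum_range_reflect]
      refine Finset.sum_congr rfl fun k hk => ?_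
      have := Finset.mem_range.1 hk
      congr 4
      omega

theorem scaledVar_eq {h : S → ℝ} (hh : MemLp h 2 π) (n : ℕ) :
    scaledVar P π h n = ENNReal.ofReal
      (⟪(hh.sub (memLp_const (∫ x, h x ∂π))).toLp, sumVarOp (kernelOp hrev) n
        (hh.sub (memLp_const (∫ x, h x ∂π))).toLp⟫_ℝ / ((n + 1 : ℕ) : ℝ)) := by
  set h₀ := (hh.sub (memLp_const (∫ x, h x ∂π))).toLp with hh₀
  have hn : ((n + 1 : ℕ) : ℝ) ≠ 0 := by positivity
  have hev := measurePreserving_eval_chainLaw hrev n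
  have hint : ∀ i, Integrable (fun x : Fin (n + 1) → S => h (x i)) (chainLaw P π n) := fun i =>
    (hh.comp_measurePreserving (hev i)).integrable one_le_two
  have hmean : ∀ i, ∫ x, h (x i) ∂(chainLaw P π n) = ∫ x, h x ∂π := fun i => by
    have hm := hh.1
    rw [← (hev i).map_eq] at hm
    rw [← integral_map (hev i).measurable.aemeasurable hm, (hev i).map_eq]
  have hE : ∫ x, ((n + 1 : ℕ) : ℝ)⁻¹ * ∑ i, h (x i) ∂(chainLaw P π n) = ∫ x, h x ∂π := by
    rw [integral_const_mul, integral_finsetSum _ fun i _ => hint i]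
    simp only [hmean, Finset.sum_const, Finset.card_univ, Fintype.card_fin, nsmul_eq_mul]
    field_simp
  have hae : ∀ᵐ x ∂(chainLaw P π n), ∀ i, h₀ (x i) = h (x i) - ∫ x, h x ∂π := by
    refine ae_all_iff.2 fun i => ?_
    exact (hev i).quasiMeasurePreserving.ae_eq_comp
      (hh.sub (memLp_const (∫ x, h x ∂π))).coeFn_toLp
  have hmem : MemLp (fun x : Fin (n + 1) → S => ∑ i, h₀ (x i)) 2 (chainLaw P π n) :=
    memLp_finsetSum _ fun i _ => (Lp.memLp h₀).comp_measurePreserving (hev i)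
  rw [scaledVar, evariance, hE, ← integral_sum_sq_chainLaw hrev]
  have h1 : ∫⁻ x : Fin (n + 1) → S, ‖((n + 1 : ℕ) : ℝ)⁻¹ * ∑ i, h (x i) - ∫ x, h x ∂π‖ₑ ^ 2
      ∂(chainLaw P π n) = ENNReal.ofReal ((((n + 1 : ℕ) : ℝ)⁻¹) ^ 2 *
        ∫ x, (∑ i, h₀ (x i)) ^ 2 ∂(chainLaw P π n)) := by
    rw [← integral_const_mul, ofReal_integral_eq_lintegral_ofReal
      (hmem.integrable_sq.const_mul _) (ae_of_all _ fun x => by positivity)]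
    refine lintegral_congr_ae ?_
    filter_upwards [hae] with x hx
    simp only [hx, Finset.sum_sub_distrib, Finset.sum_const, Finset.card_univ, Fintype.card_fin,
      nsmul_eq_mul]
    rw [← ofReal_norm, ← ENNReal.ofReal_pow (norm_nonneg _), Real.norm_eq_abs, sq_abs, ← mul_pow,
      mul_sub, inv_mul_cancel_left₀ hn]
  rw [h1, ← ENNReal.ofReal_natCast, ← ENNReal.ofReal_mul (by positivity)]
  congr 1
  field_simp

end Chain

/-! ### Variance bounding as a spectral gap on mean-zero functions. -/

section VarianceBounding

open scoped InnerProductSpace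

variable {S : Type*} [MeasurableSpace S]

/-- The mean-zero functions in `L²(π)`. -/
noncomputable def meanZero (π : Measure S) [IsProbabilityMeasure π] : Submodule ℝ (Lp ℝ 2 π) :=
  (ℝ ∙ indicatorConstLp (E := ℝ) 2 MeasurableSet.univ (measure_ne_top π Set.univ) 1)ᗮ

theorem mem_meanZero_iff {π : Measure S} [IsProbabilityMeasure π] {f : Lp ℝ 2 π} :
    f ∈ meanZero π ↔ ∫ x, f x ∂π = 0 := by
  rw [meanZero, Submodule.mem_orthogonal_singleton_iff_inner_right,
    L2.inner_indicatorConstLp_one, Measure.restrict_univ]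

instance completeSpace_meanZero (π : Measure S) [IsProbabilityMeasure π] :
    CompleteSpace (meanZero π) :=
  inferInstanceAs (CompleteSpace (_ : Submodule ℝ (Lp ℝ 2 π))ᗮ)

variable {π : Measure S} [IsProbabilityMeasure π] {P : Kernel S S} [IsMarkovKernel P]
  (hrev : (π ⊗ₘ P).map Prod.swap = π ⊗ₘ P)

theorem kernelOp_mem_meanZero : ∀ f ∈ meanZero π, kernelOp hrev f ∈ meanZero π := by
  intro f hf
  rw [mem_meanZero_iff] at hf ⊢
  have hsnd := measurePreserving_snd_compProd hrev
  have hint : Integrable (fun z : S × S => f z.2) (π ⊗ₘ P) :=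
    ((Lp.memLp f).comp_measurePreserving hsnd).integrable one_le_two
  rw [integral_congr_ae (kernelOp_ae_eq hrev f), ← Measure.integral_compProd hint,
    hsnd.integral_comp_of_aestronglyMeasurable (Lp.aestronglyMeasurable f), hf]

/-- The restriction of the kernel operator to mean-zero functions. -/
noncomputable def meanZeroOp : meanZero π →L[ℝ] meanZero π :=
  (kernelOp hrev).restrict (kernelOp_mem_meanZero hrev)

theorem coe_meanZeroOp (f : meanZero π) : (meanZeroOp hrev f : Lp ℝ 2 π) = kernelOp hrev f :=
  rfl

theorem norm_meanZeroOp_le : ‖meanZeroOp hrev‖ ≤ 1 :=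
  ContinuousLinearMap.opNorm_le_bound _ zero_le_one fun f =>
    (kernelOp hrev).le_of_opNorm_le (norm_kernelOp_le hrev) f

theorem coe_sumVarOp_meanZeroOp (n : ℕ) (f : meanZero π) :
    (sumVarOp (meanZeroOp hrev) n f : Lp ℝ 2 π) = sumVarOp (kernelOp hrev) n f := by
  have hpow : ∀ (k : ℕ) (f : meanZero π),
      ((meanZeroOp hrev ^ k) f : Lp ℝ 2 π) = (kernelOp hrev ^ k) f := fun k => by
    induction k with
    | zero => intro f; rfl
    | succ k ih =>
      intro f
      rw [pow_succ, pow_succ, mul_apply_eq_comp, mul_apply_eq_comp, ih, coe_meanZeroOp]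
  induction n with
  | zero => rfl
  | succ n ih =>
    simp only [sumVarOp, add_apply, smul_apply, Submodule.coe_add, Submodule.coe_smul, sum_apply,
      Submodule.coe_sum, ih, hpow, one_apply_eq_self]

/-- A reversible chain is variance bounding if and only if it has a (right) spectral gap. -/
theorem varianceBounding_iff_gap : VarianceBounding P π ↔ ∃ γ : ℝ, 0 < γ ∧
    ∀ f ∈ meanZero π, γ * ‖f‖ ^ 2 ≤ ⟪f, f - kernelOp hrev f⟫_ℝ := by
  constructor
  · intro hvb
    have hpos : ∀ (f : meanZero π) (n : ℕ), 0 ≤ ⟪f, sumVarOp (meanZeroOp hrev) n f⟫_ℝ := by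
      intro f n
      rw [Submodule.coe_inner, coe_sumVarOp_meanZeroOp, ← integral_sum_sq_chainLaw]
      exact integral_nonneg fun _ => sq_nonneg _
    obtain ⟨γ, hγ, h⟩ := exists_gap_of_bounded_inner_sumVarOp (meanZeroOp hrev)
      (norm_meanZeroOp_le hrev) (fun f g => kernelOp_symm hrev f g) hpos (fun f => by
        obtain ⟨v, hv, hlim⟩ := hvb f.1 (Lp.memLp f.1)
        have hlim' : Tendsto (fun n => (scaledVar P π f.1 n).toReal) atTop (𝓝 v.toReal) :=
          (ENNReal.tendsto_toReal hv.ne).comp hlim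
        -- For this direction only boundedness of the scaled variances matters, not their
        -- convergence.
        obtain ⟨C, hC⟩ := hlim'.bddAbove_range
        refine ⟨C, fun n => ?_⟩
        have h1 : (scaledVar P π f.1 n).toReal ≤ C := hC ⟨n, rfl⟩
        have hmean : ∫ x, f.1 x ∂π = 0 := mem_meanZero_iff.1 f.2
        have h2 : ((Lp.memLp f.1).sub (memLp_const (∫ x, f.1 x ∂π))).toLp = f.1 := by
          rw [MemLp.toLp_sub (Lp.memLp f.1) (memLp_const _), Lp.toLp_coeFn, sub_eq_self]
          simp only [hmean]
          rfl
        rw [scaledVar_eq hrev (Lp.memLp f.1), h2, ← coe_sumVarOp_meanZeroOp, ← Submodule.coe_inner,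
          ENNReal.toReal_ofReal (div_nonneg (hpos f n) (by positivity)),
          div_le_iff₀ (by positivity)] at h1
        exact_mod_cast h1)
    exact ⟨γ, hγ, fun f hf => h ⟨f, hf⟩⟩
  · rintro ⟨γ, hγ, h⟩ f hf
    have hmem : (hf.sub (memLp_const (∫ x, f x ∂π))).toLp ∈ meanZero π := by
      rw [mem_meanZero_iff, integral_congr_ae (MemLp.coeFn_toLp _)]
      simp only [Pi.sub_apply]
      rw [integral_sub (hf.integrable one_le_two) (integrable_const _)]
      simp
    obtain ⟨v, hv⟩ := exists_tendsto_inner_sumVarOp (meanZeroOp hrev) (norm_meanZeroOp_le hrev) hγ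
      (fun f => h f.1 f.2) ⟨_, hmem⟩
    refine ⟨ENNReal.ofReal v, ENNReal.ofReal_lt_top, ?_⟩
    refine (ENNReal.tendsto_ofReal hv).congr fun n => ?_
    rw [scaledVar_eq hrev hf, Submodule.coe_inner, coe_sumVarOp_meanZeroOp]

end VarianceBounding

/-! ### Reversibility and comparison of propose-accept-reject kernels. -/

section ParKernel

open scoped InnerProductSpace

theorem lintegral_target {S : Type*} [MeasurableSpace S] {μ : Measure S} {π : S → ℝ≥0}
    (hπ : Measurable π) {F : S → ℝ≥0∞} (hF : Measurable F) :
    ∫⁻ x, F x ∂(target μ π) = ∫⁻ x, π x * F x ∂μ := by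
  rw [target, lintegral_withDensity_eq_lintegral_mul _ hπ.coe_nnreal_ennreal hF]
  rfl

theorem isProbabilityMeasure_target {S : Type*} [MeasurableSpace S] {μ : Measure S} {π : S → ℝ≥0}
    (h : ∫⁻ x, π x ∂μ = 1) :
    IsProbabilityMeasure (target μ π) :=
  ⟨by rw [target, withDensity_apply _ MeasurableSet.univ, Measure.restrict_univ, h]⟩

variable {S : Type*} [MeasurableSpace S] {μ : Measure S} [SFinite μ] {π : S → ℝ≥0}
  {q : S → S → ℝ≥0} {α : S → S → ℝ≥0∞}

/-- The density `π(x) q(x,y) α(x,y)` of accepted moves in stationarity. -/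
noncomputable def flux (π : S → ℝ≥0) (q : S → S → ℝ≥0) (α : S → S → ℝ≥0∞) (x y : S) : ℝ≥0∞ :=
  π x * (q x y * α x y)

theorem measurable_proposal_mul (hq : Measurable (Function.uncurry q))
    (hα : Measurable (Function.uncurry α)) :
    Measurable (Function.uncurry fun x y => (q x y : ℝ≥0∞) * α x y) :=
  hq.coe_nnreal_ennreal.mul hα

theorem measurable_flux (hπ : Measurable π) (hq : Measurable (Function.uncurry q))
    (hα : Measurable (Function.uncurry α)) : Measurable (Function.uncurry (flux π q α)) :=
  (hπ.comp measurable_fst).coe_nnreal_ennreal.mul (measurable_proposal_mul hq hα)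

theorem measurable_reject (hq : Measurable (Function.uncurry q))
    (hα : Measurable (Function.uncurry α)) :
    Measurable fun x => 1 - ∫⁻ y, q x y * α x y ∂μ :=
  measurable_const.sub (measurable_proposal_mul hq hα).lintegral_prod_right'

theorem lintegral_parKernel (hq : Measurable (Function.uncurry q))
    (hα : Measurable (Function.uncurry α)) {F : S → ℝ≥0∞} (hF : Measurable F) (x : S) :
    ∫⁻ y, F y ∂(parKernel μ q α x) =
      ∫⁻ y, q x y * α x y * F y ∂μ + (1 - ∫⁻ y, q x y * α x y ∂μ) * F x := by
  have hrej : Measurable (Function.uncurry fun x (_ : S) => 1 - ∫⁻ y, q x y * α x y ∂μ) :=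
    (measurable_reject hq hα).comp measurable_fst
  rw [parKernel, add_apply, lintegral_add_measure,
    Kernel.lintegral_withDensity _ (measurable_proposal_mul hq hα) x hF,
    Kernel.lintegral_withDensity _ hrej x hF,
    Kernel.const_apply, Kernel.id_apply,
    lintegral_const_mul _ hF, lintegral_dirac' _ hF]

theorem isMarkovKernel_parKernel (hq : Measurable (Function.uncurry q))
    (hα : Measurable (Function.uncurry α)) (hα_le : ∀ x y, α x y ≤ 1)
    (hq_one : ∀ x, ∫⁻ y, q x y ∂μ = 1) : IsMarkovKernel (parKernel μ q α) := by
  refine ⟨fun x => ⟨?_⟩⟩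
  have h := lintegral_parKernel (μ := μ) hq hα (F := fun _ => 1) measurable_const x
  simp only [lintegral_const, one_mul, mul_one] at h
  rw [h]
  refine add_tsub_cancel_of_le ?_
  rw [← hq_one x]
  exact lintegral_mono fun y => mul_le_of_le_one_right' (hα_le x y)

theorem lintegral_target_compProd_parKernel [IsMarkovKernel (parKernel μ q α)]
    (hπ : Measurable π) (hq : Measurable (Function.uncurry q))
    (hα : Measurable (Function.uncurry α)) {F : S × S → ℝ≥0∞} (hF : Measurable F) :
    ∫⁻ z, F z ∂(target μ π ⊗ₘ parKernel μ q α) =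
      ∫⁻ x, ∫⁻ y, flux π q α x y * F (x, y) ∂μ ∂μ +
        ∫⁻ x, π x * ((1 - ∫⁻ y, q x y * α x y ∂μ) * F (x, x)) ∂μ := by
  have : SFinite (target μ π) := by rw [target]; infer_instance
  rw [Measure.lintegral_compProd hF, lintegral_target hπ hF.lintegral_kernel_prod_right',
    ← lintegral_add_left]
  · refine lintegral_congr fun x => ?_
    have hFx : Measurable fun y => F (x, y) := hF.comp measurable_prodMk_left
    rw [lintegral_parKernel hq hα hFx, mul_add, ← lintegral_const_mul]
    · simp only [flux, mul_assoc]
    · exact ((measurable_proposal_mul hq hα).comp measurable_prodMk_left).mul hFx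
  · exact ((measurable_flux hπ hq hα).mul hF).lintegral_prod_right'

/-- Detailed balance: the accepted part is swap-invariant by symmetry of the flux and Tonelli, the
rejected part because it lives on the diagonal. -/
theorem map_swap_target_compProd_parKernel [IsMarkovKernel (parKernel μ q α)]
    (hπ : Measurable π) (hq : Measurable (Function.uncurry q))
    (hα : Measurable (Function.uncurry α))
    (hsymm : ∀ x y, flux π q α x y = flux π q α y x) :
    (target μ π ⊗ₘ parKernel μ q α).map Prod.swap = target μ π ⊗ₘ parKernel μ q α := by
  refine Measure.ext_of_lintegral _ fun F hF => ?_
  rw [lintegral_map hF measurable_swap, lintegral_target_compProd_parKernel hπ hq hα hF,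
    lintegral_target_compProd_parKernel (F := fun z => F z.swap) hπ hq hα
      (hF.comp measurable_swap),
    lintegral_lintegral_swap]
  · simp only [Prod.swap_prod_mk]
    congr 1
    exact lintegral_congr fun x => lintegral_congr fun y => by rw [hsymm]
  · exact ((measurable_flux hπ hq hα).mul (hF.comp measurable_swap)).aemeasurable

/-- If the accepted flux of one reversible kernel is dominated by a multiple of that of another
except for proposals of arbitrarily small probability, then variance bounding carries over. -/
theorem VarianceBounding.of_flux_le {α' : S → S → ℝ≥0∞} (hπ : Measurable π)
    (hπ_one : ∫⁻ x, π x ∂μ = 1) (hq : Measurable (Function.uncurry q))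
    (hq_one : ∀ x, ∫⁻ y, q x y ∂μ = 1)
    (hα : Measurable (Function.uncurry α)) (hα_le : ∀ x y, α x y ≤ 1)
    (hsymm : ∀ x y, flux π q α x y = flux π q α y x)
    (hα' : Measurable (Function.uncurry α')) (hα'_le : ∀ x y, α' x y ≤ 1)
    (hsymm' : ∀ x y, flux π q α' x y = flux π q α' y x)
    (hcond : ∀ ε : ℝ, 0 < ε → ∃ c : ℝ≥0, ∀ᵐ x ∂(target μ π),
      ∫⁻ y in {y | c * flux π q α' x y < flux π q α x y}, q x y ∂μ ≤ ENNReal.ofReal ε)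
    (hvb : VarianceBounding (parKernel μ q α) (target μ π)) :
    VarianceBounding (parKernel μ q α') (target μ π) := by
  have := isProbabilityMeasure_target hπ_one
  have := isMarkovKernel_parKernel (μ := μ) hq hα hα_le hq_one
  have := isMarkovKernel_parKernel (μ := μ) hq hα' hα'_le hq_one
  have hrev := map_swap_target_compProd_parKernel (μ := μ) hπ hq hα hsymm
  have hrev' := map_swap_target_compProd_parKernel (μ := μ) hπ hq hα' hsymm'
  rw [varianceBounding_iff_gap hrev] at hvb
  rw [varianceBounding_iff_gap hrev']
  obtain ⟨γ, hγ, hgap⟩ := hvb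
  -- The exceptional moves cost `4 (γ / 4) ‖f‖² = γ ‖f‖²`, half of the available `2 γ ‖f‖²`. In the
  -- new gap, `c + 1` replaces `c` to avoid division by zero.
  obtain ⟨c, hc⟩ := hcond (γ / 4) (by positivity)
  refine ⟨γ / (2 * (c + 1)), by positivity, fun f hf => ?_⟩
  have hgapf := hgap f hf
  have hfm : Measurable f := (Lp.stronglyMeasurable f).measurable
  set G : S × S → ℝ≥0∞ := fun z => ‖f z.1 - f z.2‖ₑ ^ 2 with hG
  have hGm : Measurable G :=
    ((hfm.comp measurable_fst).sub (hfm.comp measurable_snd)).enorm.pow_const 2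
  have hD : ENNReal.ofReal (2 * ⟪f, f - kernelOp hrev f⟫_ℝ) =
      ∫⁻ x, ∫⁻ y, flux π q α x y * G (x, y) ∂μ ∂μ := by
    rw [← lintegral_sub_sq_eq, lintegral_target_compProd_parKernel hπ hq hα hGm]
    simp [hG]
  have hD' : ENNReal.ofReal (2 * ⟪f, f - kernelOp hrev' f⟫_ℝ) =
      ∫⁻ x, ∫⁻ y, flux π q α' x y * G (x, y) ∂μ ∂μ := by
    rw [← lintegral_sub_sq_eq, lintegral_target_compProd_parKernel hπ hq hα' hGm]
    simp [hG]
  have hfl := measurable_flux hπ hq hα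
  have hfl' := measurable_flux hπ hq hα'
  -- Defining the exceptional set by the fluxes makes it jointly measurable and symmetric.
  set B : Set (S × S) := {z | c * flux π q α' z.1 z.2 < flux π q α z.1 z.2} with hB
  have hBm : MeasurableSet B := measurableSet_lt (hfl'.const_mul _) hfl
  have hBx : ∀ x, MeasurableSet {y | c * flux π q α' x y < flux π q α x y} := fun x =>
    measurable_prodMk_left hBm
  set k : S × S → ℝ≥0∞ := B.indicator fun z => flux π q α z.1 z.2 with hk
  have hkm : Measurable k := hfl.indicator hBm
  have hkswap : ∀ x y, k (x, y) = k (y, x) := by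
    intro x y
    have hmem : (x, y) ∈ B ↔ (y, x) ∈ B := by
      simp only [hB, Set.mem_ofPred_eq]
      rw [hsymm x y, hsymm' x y]
    by_cases h : (x, y) ∈ B
    · rw [hk, Set.indicator_of_mem h, Set.indicator_of_mem (hmem.1 h)]
      exact hsymm x y
    · rw [hk, Set.indicator_of_notMem h, Set.indicator_of_notMem (fun h' => h (hmem.2 h'))]
  have hpt : ∀ x y, flux π q α x y * G (x, y) ≤
      c * (flux π q α' x y * G (x, y)) +
        (2 * (k (x, y) * ‖f x‖ₑ ^ 2) + 2 * (k (x, y) * ‖f y‖ₑ ^ 2)) := by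
    intro x y
    by_cases h : (x, y) ∈ B
    · have hkxy : k (x, y) = flux π q α x y := Set.indicator_of_mem h _
      refine le_add_left ?_
      rw [hkxy]
      have h1 : G (x, y) ≤ 2 * (‖f x‖ₑ ^ 2 + ‖f y‖ₑ ^ 2) := by
        have h2 : ((‖f x‖₊ + ‖f y‖₊ : ℝ≥0)) ^ 2 ≤ 2 * (‖f x‖₊ ^ 2 + ‖f y‖₊ ^ 2) := by
          rw [← NNReal.coe_le_coe]
          push_cast
          nlinarith [sq_nonneg (‖f x‖ - ‖f y‖)]
        calc G (x, y) ≤ (‖f x‖ₑ + ‖f y‖ₑ) ^ 2 := by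
              simp only [hG]
              gcongr
              exact enorm_sub_le
          _ ≤ _ := by
            simp only [enorm_eq_nnnorm]
            exact_mod_cast h2
      calc flux π q α x y * G (x, y) ≤ flux π q α x y * (2 * (‖f x‖ₑ ^ 2 + ‖f y‖ₑ ^ 2)) := by
            gcongr
        _ = _ := by ring
    · refine le_add_right ?_
      rw [← mul_assoc]
      gcongr
      exact not_lt.1 h
  have hL1 : Measurable fun z : S × S => k z * ‖f z.1‖ₑ ^ 2 :=
    hkm.mul ((hfm.comp measurable_fst).enorm.pow_const 2)
  have hL2 : Measurable fun z : S × S => k z * ‖f z.2‖ₑ ^ 2 :=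
    hkm.mul ((hfm.comp measurable_snd).enorm.pow_const 2)
  -- Only the proposals leaving `x` are controlled, so the `f y` term is moved to the `f x` term by
  -- symmetry.
  have hswap : ∫⁻ x, ∫⁻ y, k (x, y) * ‖f y‖ₑ ^ 2 ∂μ ∂μ =
      ∫⁻ x, ∫⁻ y, k (x, y) * ‖f x‖ₑ ^ 2 ∂μ ∂μ := by
    rw [lintegral_lintegral_swap hL2.aemeasurable]
    exact lintegral_congr fun x => lintegral_congr fun y => by rw [hkswap]
  have hnorm : ∫⁻ x, ‖f x‖ₑ ^ 2 ∂(target μ π) = ENNReal.ofReal (‖f‖ ^ 2) := by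
    rw [← real_inner_self_eq_norm_sq, L2.inner_def,
      ofReal_integral_eq_lintegral_ofReal (L2.integrable_inner _ _)
        (ae_of_all _ fun _ => real_inner_self_nonneg)]
    refine lintegral_congr fun x => ?_
    rw [real_inner_self_eq_norm_sq, ENNReal.ofReal_pow (norm_nonneg _), ofReal_norm]
  have hbad : ∫⁻ x, ∫⁻ y, k (x, y) * ‖f x‖ₑ ^ 2 ∂μ ∂μ ≤
      ENNReal.ofReal (γ / 4) * ENNReal.ofReal (‖f‖ ^ 2) := by
    have hqm : Measurable fun x => ∫⁻ y in {y | c * flux π q α' x y < flux π q α x y}, q x y ∂μ := by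
      have h1 : ∀ x, ∫⁻ y in {y | c * flux π q α' x y < flux π q α x y}, q x y ∂μ =
          ∫⁻ y, B.indicator (fun z => (q z.1 z.2 : ℝ≥0∞)) (x, y) ∂μ := by
        intro x
        rw [← lintegral_indicator (hBx x)]
        rfl
      simp_rw [h1]
      exact (hq.coe_nnreal_ennreal.indicator hBm).lintegral_prod_right'
    calc ∫⁻ x, ∫⁻ y, k (x, y) * ‖f x‖ₑ ^ 2 ∂μ ∂μ
        ≤ ∫⁻ x, π x * (‖f x‖ₑ ^ 2 *
            ∫⁻ y in {y | c * flux π q α' x y < flux π q α x y}, q x y ∂μ) ∂μ := by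
          refine lintegral_mono fun x => ?_
          dsimp only
          have hkx : Measurable fun y => k (x, y) := hkm.comp measurable_prodMk_left
          rw [lintegral_mul_const _ hkx, ← mul_assoc, mul_comm,
            mul_comm (π x : ℝ≥0∞), mul_assoc]
          gcongr
          rw [← lintegral_indicator (hBx x), ← lintegral_const_mul]
          · refine lintegral_mono fun y => ?_
            by_cases h : (x, y) ∈ B
            · have h' : y ∈ {y | c * flux π q α' x y < flux π q α x y} := h
              rw [hk, Set.indicator_of_mem h, Set.indicator_of_mem h', flux]
              gcongr
              exact mul_le_of_le_one_right' (hα_le x y)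
            · rw [hk, Set.indicator_of_notMem h]
              exact zero_le
          · exact (hq.coe_nnreal_ennreal.comp measurable_prodMk_left).indicator (hBx x)
      _ = ∫⁻ x, ‖f x‖ₑ ^ 2 *
            ∫⁻ y in {y | c * flux π q α' x y < flux π q α x y}, q x y ∂μ ∂(target μ π) := by
          exact (lintegral_target hπ ((hfm.enorm.pow_const 2).mul hqm)).symm
      _ ≤ ∫⁻ x, ‖f x‖ₑ ^ 2 * ENNReal.ofReal (γ / 4) ∂(target μ π) := by
          refine lintegral_mono_ae ?_
          filter_upwards [hc] with x hx
          gcongr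
      _ = _ := by rw [lintegral_mul_const _ (hfm.enorm.pow_const 2), hnorm, mul_comm]
  have hmain : ENNReal.ofReal (2 * ⟪f, f - kernelOp hrev f⟫_ℝ) ≤
      c * ENNReal.ofReal (2 * ⟪f, f - kernelOp hrev' f⟫_ℝ) +
        4 * (ENNReal.ofReal (γ / 4) * ENNReal.ofReal (‖f‖ ^ 2)) := by
    rw [hD, hD']
    calc ∫⁻ x, ∫⁻ y, flux π q α x y * G (x, y) ∂μ ∂μ
        ≤ ∫⁻ x, ∫⁻ y, c * (flux π q α' x y * G (x, y)) +
            (2 * (k (x, y) * ‖f x‖ₑ ^ 2) + 2 * (k (x, y) * ‖f y‖ₑ ^ 2)) ∂μ ∂μ :=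
          lintegral_mono fun x => lintegral_mono fun y => hpt x y
      _ = ∫⁻ x, (c * ∫⁻ y, flux π q α' x y * G (x, y) ∂μ +
            (2 * ∫⁻ y, k (x, y) * ‖f x‖ₑ ^ 2 ∂μ + 2 * ∫⁻ y, k (x, y) * ‖f y‖ₑ ^ 2 ∂μ)) ∂μ := by
          refine lintegral_congr fun x => ?_
          have e1 : Measurable fun y => flux π q α' x y * G (x, y) :=
            (hfl'.mul hGm).comp measurable_prodMk_left
          have e2 : Measurable fun y => k (x, y) * ‖f x‖ₑ ^ 2 := hL1.comp measurable_prodMk_left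
          have e3 : Measurable fun y => k (x, y) * ‖f y‖ₑ ^ 2 := hL2.comp measurable_prodMk_left
          rw [lintegral_add_left (e1.const_mul _), lintegral_add_left (e2.const_mul _),
            lintegral_const_mul _ e1, lintegral_const_mul _ e2, lintegral_const_mul _ e3]
      _ = c * ∫⁻ x, ∫⁻ y, flux π q α' x y * G (x, y) ∂μ ∂μ +
            (2 * ∫⁻ x, ∫⁻ y, k (x, y) * ‖f x‖ₑ ^ 2 ∂μ ∂μ +
              2 * ∫⁻ x, ∫⁻ y, k (x, y) * ‖f y‖ₑ ^ 2 ∂μ ∂μ) := by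
          have e1 : Measurable fun x => ∫⁻ y, flux π q α' x y * G (x, y) ∂μ :=
            (hfl'.mul hGm).lintegral_prod_right'
          have e2 : Measurable fun x => ∫⁻ y, k (x, y) * ‖f x‖ₑ ^ 2 ∂μ := hL1.lintegral_prod_right'
          have e3 : Measurable fun x => ∫⁻ y, k (x, y) * ‖f y‖ₑ ^ 2 ∂μ := hL2.lintegral_prod_right'
          rw [lintegral_add_left (e1.const_mul _), lintegral_add_left (e2.const_mul _),
            lintegral_const_mul _ e1, lintegral_const_mul _ e2, lintegral_const_mul _ e3]
      _ ≤ _ := by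
          rw [hswap, ← add_mul]
          gcongr
          norm_num
  have hnn : 0 ≤ ⟪f, f - kernelOp hrev' f⟫_ℝ := by
    rw [inner_sub_right, real_inner_self_eq_norm_sq, sub_nonneg]
    refine (real_inner_le_norm _ _).trans ?_
    rw [pow_two]
    gcongr
    simpa using (kernelOp hrev').le_of_opNorm_le (norm_kernelOp_le hrev') f
  have h4 : (4 : ℝ≥0∞) = ENNReal.ofReal 4 := by simp
  rw [← ENNReal.ofReal_coe_nnreal, ← ENNReal.ofReal_mul (by positivity),
    ← ENNReal.ofReal_mul (by positivity), h4, ← ENNReal.ofReal_mul (by positivity),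
    ← ENNReal.ofReal_add (by positivity) (by positivity),
    ENNReal.ofReal_le_ofReal_iff (by positivity)] at hmain
  rw [div_mul_eq_mul_div, div_le_iff₀ (by positivity)]
  nlinarith [c.2]

end ParKernel

/-! ### Acceptance ratios and the pointwise flux bound. -/

section Ratios

theorem min_one_mul_le_exp_mul {r₁ r₂ m : ℝ} (h₁ : 0 < r₁) (h₂ : 0 < r₂)
    (h : min |Real.log r₁| |Real.log r₂| ≤ m ∨ 0 ≤ Real.log r₁ * Real.log r₂) :
    min 1 (r₁ * r₂) ≤ Real.exp |m| * (min 1 r₁ * min 1 r₂) := by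
  have he : 1 ≤ Real.exp |m| := Real.one_le_exp (abs_nonneg m)
  have hnn : 0 ≤ min 1 r₁ * min 1 r₂ := by positivity
  -- Here `exp (-|m|) ≤ a ≤ exp |m|`, so the factor `a` costs at most `exp |m|`. The absolute value
  -- keeps the constant at least `1` for every real `m`.
  have key : ∀ a b : ℝ, 0 < a → 0 < b → |Real.log a| ≤ m →
      min 1 (a * b) ≤ Real.exp |m| * (min 1 a * min 1 b) := by
    intro a b ha hb hab
    have h1 := (abs_le.1 (hab.trans (le_abs_self m)))
    rcases le_total a 1 with h | h
    · have h2 : 1 ≤ Real.exp |m| * a := by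
        rw [← Real.exp_log ha, ← Real.exp_add]
        exact Real.one_le_exp (by linarith)
      rw [min_eq_right h, ← mul_assoc]
      have h3 : min 1 (a * b) ≤ min 1 b :=
        min_le_min_left _ (mul_le_of_le_one_left hb.le h)
      exact h3.trans (le_mul_of_one_le_left (by positivity) h2)
    · have h2 : a ≤ Real.exp |m| := by
        rw [← Real.log_le_iff_le_exp ha]; exact h1.2
      rw [min_eq_left h, one_mul]
      rcases le_total b 1 with hb1 | hb1
      · rw [min_eq_right hb1]
        exact (min_le_right _ _).trans (by gcongr)
      · rw [min_eq_left hb1, mul_one]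
        exact (min_le_left _ _).trans he
  rcases h with h | h
  · rcases min_le_iff.1 h with h | h
    · exact key r₁ r₂ h₁ h₂ h
    · rw [mul_comm r₁, mul_comm (min 1 r₁)]
      exact key r₂ r₁ h₂ h₁ h
  · refine le_trans ?_ (le_mul_of_one_le_left hnn he)
    rcases le_total r₁ 1 with h3 | h3 <;> rcases le_total r₂ 1 with h4 | h4
    · rw [min_eq_right h3, min_eq_right h4]
      exact min_le_right _ _
    · rcases h3.eq_or_lt with rfl | h3
      · simp
      rcases h4.eq_or_lt with rfl | h4
      · simp
      exact absurd h (not_le.2 (mul_neg_of_neg_of_pos (Real.log_neg h₁ h3) (Real.log_pos h4)))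
    · rcases h3.eq_or_lt with rfl | h3
      · simp
      rcases h4.eq_or_lt with rfl | h4
      · simp
      exact absurd h (not_le.2 (mul_neg_of_pos_of_neg (Real.log_pos h3) (Real.log_neg h₂ h4)))
    · rw [min_eq_left h3, min_eq_left h4, one_mul]
      exact min_le_left _ _

theorem ENNReal.mul_min_one_div {a b : ℝ≥0∞} (ha : a ≠ ∞) : a * min 1 (b / a) = min a b ∨ a = 0 := by
  rcases eq_or_ne a 0 with h | h
  · exact Or.inr h
  · left
    rw [mul_min, mul_one, ENNReal.mul_div_cancel h ha]

variable {S : Type*} {π πhat : S → ℝ≥0} {q : S → S → ℝ≥0}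

theorem flux_alphaMH (x y : S) :
    flux π q (alphaMH π q) x y = min ((π x : ℝ≥0∞) * q x y) ((π y : ℝ≥0∞) * q y x) := by
  rw [flux, alphaMH, rMH, ← mul_assoc]
  rcases ENNReal.mul_min_one_div (a := (π x : ℝ≥0∞) * q x y) (b := (π y : ℝ≥0∞) * q y x)
    (by finiteness) with h | h
  · exact h
  · simp [h]

/-- Writing `π = πhat * (π / πhat)`, each stage is an instance of `a (1 ∧ b / a) = a ∧ b`. The
resulting form is visibly symmetric, giving reversibility of delayed acceptance. -/
theorem flux_alphaDA (hpos : ∀ x, 0 < π x → 0 < πhat x) (x y : S) :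
    flux π q (alphaDA π πhat q) x y =
      min ((πhat x : ℝ≥0∞) * q x y) ((πhat y : ℝ≥0∞) * q y x) *
        min ((π x : ℝ≥0∞) / πhat x) ((π y : ℝ≥0∞) / πhat y) := by
  rw [flux, alphaDA, rDA₁, rDA₂]
  rcases eq_or_ne (π x) 0 with h0 | h0
  · simp [h0]
  have hh : (πhat x : ℝ≥0∞) ≠ 0 := by
    exact_mod_cast (hpos x (pos_iff_ne_zero.2 h0)).ne'
  have hu : (π x : ℝ≥0∞) / πhat x ≠ 0 := (ENNReal.div_pos (by exact_mod_cast h0) (by simp)).ne'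
  have hu' : (π x : ℝ≥0∞) / πhat x ≠ ∞ := ENNReal.div_ne_top (by simp) hh
  have hmul : (π x : ℝ≥0∞) = πhat x * ((π x : ℝ≥0∞) / πhat x) :=
    (ENNReal.mul_div_cancel hh (by simp)).symm
  have h2 := (ENNReal.mul_min_one_div (b := (π y : ℝ≥0∞) / πhat y) hu').resolve_right hu
  rw [← h2]
  nth_rw 1 [hmul]
  rcases ENNReal.mul_min_one_div (a := (πhat x : ℝ≥0∞) * q x y) (b := (πhat y : ℝ≥0∞) * q y x)
    (by finiteness) with h | h
  · rw [← h]
    ring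
  · rw [h]
    rcases mul_eq_zero.1 h with h | h
    · exact absurd h hh
    · simp [h]

theorem flux_alphaMH_symm (x y : S) :
    flux π q (alphaMH π q) x y = flux π q (alphaMH π q) y x := by
  rw [flux_alphaMH, flux_alphaMH, min_comm]

theorem flux_alphaDA_symm (hpos : ∀ x, 0 < π x → 0 < πhat x) (x y : S) :
    flux π q (alphaDA π πhat q) x y = flux π q (alphaDA π πhat q) y x := by
  rw [flux_alphaDA hpos, flux_alphaDA hpos, min_comm, min_comm ((π x : ℝ≥0∞) / πhat x)]

theorem flux_alphaMH_le_of_imp (hpos : ∀ x, 0 < π x → 0 < πhat x) {m : ℝ} {x y : S}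
    (h : y ∈ potentialProblemSet π πhat q m x → y ∈ noProblemSet π πhat q x) :
    flux π q (alphaMH π q) x y ≤
      (Real.exp |m|).toNNReal * flux π q (alphaDA π πhat q) x y := by
  -- A positive MH flux forces every density involved to be positive, so no conventions at `0` or
  -- `∞` intervene: the ratios are positive reals with `r = r₁ r₂`.
  rcases eq_or_ne (flux π q (alphaMH π q) x y) 0 with h0 | h0
  · rw [h0]; exact zero_le
  rw [flux_alphaMH, ← pos_iff_ne_zero, lt_min_iff] at h0
  obtain ⟨hx, hy⟩ := h0
  rw [pos_iff_ne_zero, Ne, mul_eq_zero, not_or] at hx hy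
  have hπx : π x ≠ 0 := by exact_mod_cast hx.1
  have hqx : q x y ≠ 0 := by exact_mod_cast hx.2
  have hπy : π y ≠ 0 := by exact_mod_cast hy.1
  have hqy : q y x ≠ 0 := by exact_mod_cast hy.2
  have hhx : πhat x ≠ 0 := (hpos x (pos_iff_ne_zero.2 hπx)).ne'
  have hhy : πhat y ≠ 0 := (hpos y (pos_iff_ne_zero.2 hπy)).ne'
  set s₁ : ℝ≥0 := (πhat y * q y x) / (πhat x * q x y) with hs₁
  set s₂ : ℝ≥0 := (π y / πhat y) / (π x / πhat x) with hs₂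
  have hs₁0 : s₁ ≠ 0 := div_ne_zero (mul_ne_zero hhy hqy) (mul_ne_zero hhx hqx)
  have hs₂0 : s₂ ≠ 0 := div_ne_zero (div_ne_zero hπy hhy) (div_ne_zero hπx hhx)
  have hr₁ : rDA₁ πhat q x y = s₁ := by
    rw [rDA₁, hs₁, ENNReal.coe_div (mul_ne_zero hhx hqx), ENNReal.coe_mul, ENNReal.coe_mul]
  have hr₂ : rDA₂ π πhat x y = s₂ := by
    rw [rDA₂, hs₂, ENNReal.coe_div (div_ne_zero hπx hhx), ENNReal.coe_div hhy, ENNReal.coe_div hhx]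
  have hr : rMH π q x y = ((s₁ * s₂ : ℝ≥0) : ℝ≥0∞) := by
    have : s₁ * s₂ = (π y * q y x) / (π x * q x y) := by
      rw [hs₁, hs₂]; field_simp
    rw [this, rMH, ENNReal.coe_div (mul_ne_zero hπx hqx), ENNReal.coe_mul, ENNReal.coe_mul]
  have h₁ : (0 : ℝ) < s₁ := by exact_mod_cast pos_iff_ne_zero.2 hs₁0
  have h₂ : (0 : ℝ) < s₂ := by exact_mod_cast pos_iff_ne_zero.2 hs₂0
  have hcase : min |Real.log s₁| |Real.log s₂| ≤ m ∨ 0 ≤ Real.log s₁ * Real.log s₂ := by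
    rw [potentialProblemSet, noProblemSet, Set.mem_ofPred_eq, Set.mem_ofPred_eq, hr₁, hr₂,
      ENNReal.log_of_nnreal hs₁0, ENNReal.log_of_nnreal hs₂0, EReal.sign_coe, EReal.sign_coe,
      ← sign_mul, sign_nonneg_iff, EReal.abs_def, EReal.abs_def,
      ← ENNReal.ofReal_mono.map_min, EReal.coe_ennreal_ofReal,
      max_eq_left (le_min (abs_nonneg _) (abs_nonneg _)), EReal.coe_lt_coe_iff] at h
    by_cases hm : m < min |Real.log s₁| |Real.log s₂|
    · exact Or.inr (h hm)
    · exact Or.inl (not_lt.1 hm)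
  have hmain := min_one_mul_le_exp_mul h₁ h₂ hcase
  have hα : alphaMH π q x y ≤ (Real.exp |m|).toNNReal * alphaDA π πhat q x y := by
    rw [alphaMH, alphaDA, hr, hr₁, hr₂]
    have : min 1 (s₁ * s₂) ≤ (Real.exp |m|).toNNReal * (min 1 s₁ * min 1 s₂) := by
      rw [← NNReal.coe_le_coe]
      push_cast
      rw [Real.coe_toNNReal _ (Real.exp_nonneg _)]
      exact hmain
    exact_mod_cast this
  rw [flux, flux]
  calc (π x : ℝ≥0∞) * (q x y * alphaMH π q x y)
      ≤ π x * (q x y * ((Real.exp |m|).toNNReal * alphaDA π πhat q x y)) := by gcongr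
    _ = _ := by ring

variable [MeasurableSpace S]

theorem measurable_alphaMH (hπ : Measurable π) (hq : Measurable (Function.uncurry q)) :
    Measurable (Function.uncurry (alphaMH π q)) := by
  have h1 : Measurable fun z : S × S => (q z.1 z.2 : ℝ≥0∞) := hq.coe_nnreal_ennreal
  have h2 : Measurable fun z : S × S => (q z.2 z.1 : ℝ≥0∞) := h1.comp measurable_swap
  have h3 : Measurable fun x => (π x : ℝ≥0∞) := hπ.coe_nnreal_ennreal
  exact measurable_const.min (((h3.comp measurable_snd).mul h2).div ((h3.comp measurable_fst).mul h1))

theorem measurable_alphaDA (hπ : Measurable π) (hπhat : Measurable πhat)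
    (hq : Measurable (Function.uncurry q)) :
    Measurable (Function.uncurry (alphaDA π πhat q)) := by
  have h3 : Measurable fun x => (π x : ℝ≥0∞) / πhat x :=
    hπ.coe_nnreal_ennreal.div hπhat.coe_nnreal_ennreal
  exact (measurable_alphaMH hπhat hq).mul
    (measurable_const.min ((h3.comp measurable_snd).div (h3.comp measurable_fst)))

end Ratios

/-! ### The comparison applied to delayed acceptance. -/

theorem corollary1 {d : ℕ} (X : Set (LebesgueSpace d)) (hX : MeasurableSet X)
    (π πhat : X → ℝ≥0) (q : X → X → ℝ≥0)
    (hπ : Measurable π)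
    (hπ_one : ∫⁻ x, π x ∂(lebesgueOn X) = 1)
    (hπhat : Measurable πhat)
    (hπhat_pos : ∀ x, 0 < π x → 0 < πhat x)
    (hq : Measurable (Function.uncurry q))
    (hq_one : ∀ x, ∫⁻ y, q x y ∂(lebesgueOn X) = 1)
    (hcond : ∀ ε : ℝ, 0 < ε → ∃ m : ℝ,
      ∀ᵐ x ∂(target (lebesgueOn X) π),
        ∃ D : Set X, MeasurableSet D ∧
          potentialProblemSet π πhat q m x ∩ D ⊆
            noProblemSet π πhat q x ∧
          ∫⁻ y in Dᶜ, q x y ∂(lebesgueOn X) ≤ ENNReal.ofReal ε)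
    (hMH : VarianceBounding
      (kernelMH (lebesgueOn X) π q)
      (target (lebesgueOn X) π)) :
    VarianceBounding
      (kernelDA (lebesgueOn X) π πhat q)
      (target (lebesgueOn X) π) := by
  refine VarianceBounding.of_flux_le hπ hπ_one hq hq_one (measurable_alphaMH hπ hq)
    (fun _ _ => min_le_left _ _) flux_alphaMH_symm (measurable_alphaDA hπ hπhat hq)
    (fun _ _ => mul_le_one' (min_le_left _ _) (min_le_left _ _))
    (flux_alphaDA_symm hπhat_pos) (fun ε hε => ?_) hMH
  obtain ⟨m, hm⟩ := hcond ε hε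
  refine ⟨(Real.exp |m|).toNNReal, ?_⟩
  filter_upwards [hm] with x ⟨D, _, hsub, hD⟩
  -- The set where the flux bound fails is contained in `Dᶜ`: for `y ∈ D` the inclusion in the
  -- hypothesis yields the bound.
  refine (lintegral_mono_set fun y hy hyD => ?_).trans hD
  exact not_lt.2 (flux_alphaMH_le_of_imp hπhat_pos fun hM => hsub ⟨hM, hyD⟩) hy
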